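/- Theorem (sequential halving with a single abrupt change). Let $N=2^L$ with $L\ge 1$, write $\log=\log_2$, and let $T$ be a multiple of $N\log N$. There are $N$ beams with means $\mu_i\ge 0$, and $T$ time slots. Beam $k$ is the $K$-th best beam, i.e. $K=1+\#\{i:\mu_i>\mu_k\}$. At a random time $t_c\in\{0,\dots,T\}$, of arbitrary distribution, the mean of beam $k$ alone changes from $\mu_k=\mu_k^-$ to $\mu_k^+$, where $\mu_k^+>\mu_i$ for all $i\ne k$. Thus $\mu_i(t)=\mu_i$ for $i\neq k$, while $\mu_k(t)=\mu_k^-$ for $t\le t_c$ and $\mu_k(t)=\mu_k^+$ for $t>t_c$. Given $t_c$, the rewards $R_i(t)$ ($1\le i\le N$, $1\le t\le T$) are independent and Gaussian with mean $\mu_i(t)$ and variance $2\sigma^2\mu_i(t)$, where $\sigma>0$. Let $\mu_{\max}$ be the largest mean of a beam and $\Delta_{\min}$ the smallest absolute difference between the means of two different beams, both taken over the means before and the means after the change, and let $\sigma_{\max}^2=2\sigma^2\mu_{\max}$. Sequential halving (SH) runs for $\log N$ rounds. All beams enter round $1$; a set $S_r$ of $N/2^{r-1}$ beams enters round $r$,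 each of them is sampled $n_r=2^{r-1}T/(N\log N)$ times in a round-robin manner in consecutive slots, and the $|S_r|/2$ beams of $S_r$ with the highest sample means of that round (ties broken by index) form $S_{r+1}$. The beam left after round $\log N$ is selected. An error occurs if the selected beam does not maximise $\mu_i(T)$; let $\mathcal P^{\rm SH}_{\rm C}$ be the probability of error, and $\mathcal P^{\rm SH}_{\rm C}(T\mid A)$ its conditional probability given an event $A$. Let $r_c$ be the round that contains slot $t_c$ (with $r_c=1$ if $t_c=0$), let $r^*=\lfloor\log\frac{N}{2K}\rfloor+1$, and let $$\mathcal T_1(r_c)=\mathbb E\left[r_c-r^*\mid r^*\le r_c\le\log N\right]$$ (read as $0$ if the condition has probability $0$). Then $$\mathcal P^{\rm SH}_{\rm C}=\mathcal P^{\rm SH}_{\rm C}(T\mid r_c\le r^*)\,\mathbb P(r_c\le r^*)+\mathcal P^{\rm SH}_{\rm C}(T\mid r_c>r^*)\,\mathbb P(r_c>r^*)$$ $$\le \mathcal T_1(r_c)+2\left(2\log N+K-1\right)\exp\left(-\frac12\,\frac{\Delta_{\min}^2T}{2\sigma_{\max}^2\,N\log N}\right).$$ In particular, if the rewards are normalised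 so that $2\sigma_{\max}^2\le 1$, then $$\mathcal P^{\rm SH}_{\rm C}\le \mathcal T_1(r_c)+2\left(2\log N+K-1\right)\exp\left(-\frac12\,\frac{\Delta_{\min}^2T}{N\log N}\right).$$ -/

import Mathlib

open MeasureTheory ProbabilityTheory

noncomputable section

namespace BeamSH

/-! ### Sequential halving with round-robin sampling

There are `N` beams, `T` time slots numbered `1, …, T`, and rounds numbered `1, …, log₂ N`.
A realisation of the rewards is a table `x i t` (the reward of beam `i` in slot `t`). -/

/-- `n_r = 2 ^ (r - 1) T / (N log₂ N)`, the number of samples of each surviving beam in round `r`.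
(The division is exact in the theorem, where `N log₂ N` divides `T`.) -/
def samples (N T r : ℕ) : ℕ := 2 ^ (r - 1) * T / (N * Nat.log 2 N)

/-- The last slot of round `r` (and `0` for `r = 0`): round `v` uses `|S_v| n_v` slots, where
`|S_v| = N / 2 ^ (v - 1)` beams enter round `v`. -/
def roundEnd (N T r : ℕ) : ℕ := ∑ v ∈ Finset.Icc 1 r, N / 2 ^ (v - 1) * samples N T v

/-- The (zero-based) position of beam `i` among the surviving beams `S`, in index order. -/
def position {N : ℕ} (S : Finset (Fin N)) (i : Fin N) : ℕ := (S.filter (fun j => j < i)).card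

/-- Round-robin sampling: the slot in which beam `i ∈ S` gets its sample number `k`
(`k = 0, …, n_r - 1`) in round `r`, when the set `S` enters that round. -/
def slot {N : ℕ} (T r : ℕ) (S : Finset (Fin N)) (i : Fin N) (k : ℕ) : ℕ :=
  roundEnd N T (r - 1) + S.card * k + position S i + 1

/-- The sample mean of beam `i` at the end of round `r`, when the set `S` enters that round. -/
def sampleMean {N : ℕ} (T r : ℕ) (x : Fin N → ℕ → ℝ) (S : Finset (Fin N)) (i : Fin N) : ℝ :=
  (∑ k ∈ Finset.range (samples N T r), x i (slot T r S i k)) / (samples N T r : ℝ)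

/-- Beam `j` is ranked above beam `i`: its score is larger (ties are broken by the index). -/
def RankedAbove {N : ℕ} (score : Fin N → ℝ) (j i : Fin N) : Prop :=
  score i < score j ∨ (score j = score i ∧ j < i)

open Classical in
/-- The top half of `S`: the beams with fewer than `|S| / 2` beams of `S` ranked above them. -/
def topHalf {N : ℕ} (score : Fin N → ℝ) (S : Finset (Fin N)) : Finset (Fin N) :=
  S.filter (fun i => (S.filter (fun j => RankedAbove score j i)).card < S.card / 2)

/-- The set of beams that survive the first `q` rounds of sequential halving. -/
def survivors {N : ℕ} (T : ℕ) (x : Fin N → ℕ → ℝ) : ℕ → Finset (Fin N)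
  | 0 => Finset.univ
  | q + 1 => topHalf (sampleMean T (q + 1) x (survivors T x q)) (survivors T x q)

/-- The beam `b` is the one that sequential halving selects: it alone survives all the rounds. -/
def Selects {N : ℕ} (T : ℕ) (x : Fin N → ℕ → ℝ) (b : Fin N) : Prop :=
  survivors T x (Nat.log 2 N) = {b}

/-! ### The environment with a single abrupt change -/

/-- The means after the change: only the mean of beam `k` changes, to `μplus`. -/
def meanAfter {N : ℕ} (μ : Fin N → ℝ) (k : Fin N) (μplus : ℝ) : Fin N → ℝ :=
  Function.update μ k μplus

/-- `μ_i(t)`, the mean of beam `i` in slot `t` when the change time is `s`. -/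
def meanAt {N : ℕ} (μ : Fin N → ℝ) (k : Fin N) (μplus : ℝ) (s t : ℕ) (i : Fin N) : ℝ :=
  if t ≤ s then μ i else meanAfter μ k μplus i

/-- The random change time `tc ∈ {0, …, T}` and the rewards `R i t`, `1 ≤ t ≤ T`: given `tc = s`,
the rewards are independent, and `R i t` is Gaussian with mean `μ_i(t)` and variance
`2 σ² μ_i(t)`. The law of `tc` on `{0, …, T}` is arbitrary. -/
structure IsChangeModel {Ω : Type*} [MeasurableSpace Ω] (P : Measure Ω) {N : ℕ} (T : ℕ) (σ : ℝ)
    (μ : Fin N → ℝ) (k : Fin N) (μplus : ℝ) (tc : Ω → ℕ) (R : Fin N → ℕ → Ω → ℝ) : Prop where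
  measurable_tc : Measurable tc
  tc_le : ∀ ω, tc ω ≤ T
  measurable_reward : ∀ i, ∀ t ∈ Finset.Icc 1 T, Measurable (R i t)
  law : ∀ s, P (tc ⁻¹' {s}) ≠ 0 → ∀ i, ∀ t ∈ Finset.Icc 1 T,
    (cond P (tc ⁻¹' {s})).map (R i t) =
      gaussianReal (meanAt μ k μplus s t i) (2 * σ ^ 2 * meanAt μ k μplus s t i).toNNReal
  indep : ∀ s, P (tc ⁻¹' {s}) ≠ 0 →
    iIndepFun (fun (p : Fin N × Finset.Icc 1 T) => R p.1 p.2) (cond P (tc ⁻¹' {s}))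

/-- The minimum difference between the means of two different beams. -/
def minGap {N : ℕ} (μ : Fin N → ℝ) : ℝ :=
  ⨅ p : {p : Fin N × Fin N // p.1 ≠ p.2}, |μ p.1.1 - μ p.1.2|

/-- `Δ_min`: the minimum difference between the means of two beams, before and after the change. -/
def deltaMin {N : ℕ} (μ : Fin N → ℝ) (k : Fin N) (μplus : ℝ) : ℝ :=
  min (minGap μ) (minGap (meanAfter μ k μplus))

/-- `μ_max`: the maximum mean of a beam, before and after the change. -/
def muMax {N : ℕ} (μ : Fin N → ℝ) (k : Fin N) (μplus : ℝ) : ℝ :=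
  max (⨆ i, μ i) (⨆ i, meanAfter μ k μplus i)

/-- `σ²_max = 2 σ² μ_max`. -/
def sigmaMaxSq {N : ℕ} (σ : ℝ) (μ : Fin N → ℝ) (k : Fin N) (μplus : ℝ) : ℝ :=
  2 * σ ^ 2 * muMax μ k μplus

/-- The rank of beam `k` for the means `μ`: beam `k` is the `rank`-th best beam. -/
def rank {N : ℕ} (μ : Fin N → ℝ) (k : Fin N) : ℕ :=
  (Finset.univ.filter (fun i => μ k < μ i)).card + 1

/-- `r_c`, the round that contains the slot `s` after which the change occurs (round `1` for
`s = 0`). -/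
def changeRound (N T s : ℕ) : ℕ := sInf {r | 1 ≤ r ∧ s ≤ roundEnd N T r}

/-- `r* = log₂ (N / (2 K)) + 1`, rounded down to an integer. -/
def rStar (N K : ℕ) : ℤ := ⌊Real.logb 2 ((N : ℝ) / (2 * (K : ℝ)))⌋ + 1

/-- The event of a beam-selection error: the selected beam does not maximise `μ_i(T)`. -/
def errorEvent {Ω : Type*} {N : ℕ} (T : ℕ) (μ : Fin N → ℝ) (k : Fin N) (μplus : ℝ)
    (tc : Ω → ℕ) (R : Fin N → ℕ → Ω → ℝ) : Set Ω :=
  {ω | ¬ ∃ b, Selects T (fun i t => R i t ω) b ∧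
    ∀ i, meanAt μ k μplus (tc ω) T i ≤ meanAt μ k μplus (tc ω) T b}

/-- The event `r_c ≤ r*` of an early change. -/
def earlyChange {Ω : Type*} (N T K : ℕ) (tc : Ω → ℕ) : Set Ω :=
  {ω | (changeRound N T (tc ω) : ℤ) ≤ rStar N K}

/-- The event `r_c > r*` of a late change. -/
def lateChange {Ω : Type*} (N T K : ℕ) (tc : Ω → ℕ) : Set Ω :=
  {ω | rStar N K < (changeRound N T (tc ω) : ℤ)}

/-- `𝒯₁(r_c) = E[r_c - r* | r* ≤ r_c ≤ log₂ N]`; it is `0` if the condition has probability `0`. -/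
def lateTerm {Ω : Type*} [MeasurableSpace Ω] (P : Measure Ω) (N T K : ℕ) (tc : Ω → ℕ) : ℝ :=
  ∫ ω, ((changeRound N T (tc ω) : ℝ) - (rStar N K : ℝ))
    ∂(cond P {ω | rStar N K ≤ (changeRound N T (tc ω) : ℤ) ∧
      changeRound N T (tc ω) ≤ Nat.log 2 N})

end BeamSH

end

namespace BeamSH

/-! ### Ranking and halving -/

/-! Split according to the round r_c of the change. On r_c > r* the error probability is bounded
trivially by the probability of that event. As r_c is an integer that never exceeds log N, the
difference r_c - r* is at least 1 there and nonnegative on the conditioning event of 𝒯₁, so 𝒯₁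
dominates P(r_c > r*) (`measureReal_lateChange_le_lateTerm`).

On r_c ≤ r*, fix t_c = s. If T > 0, beam k is optimal in the last slot, so an error forces its
elimination in some round. Suppose 2h beams enter a round and all rivals of k but b < h are worse
than k by Δ_min throughout it. Elimination needs h rivals scoring at least as well as k, hence at
least h - b of the worse ones. By Gaussian concentration each of these does so with probability at
most p = exp(-Δ_min² T / (4 σ_max² N log N)), and Markov's inequality for their number bounds the
elimination probability by 2hp/(h - b) (`mul_measureReal_eliminated_le`). The set of entrants is
random, but it depends on earlier slots only, so it is independent of the rewards of the round
(`measureReal_survivors_inter`).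

Up to round r* one has b ≤ K - 1, and r* is the last round with h ≥ K. Before r*, h ≥ 2K and the
cost is at most 4p; in round r* it is at most 2Kp ≤ (4 + 2K - 2)p; after r* the change has already
happened, so b = 0 and the cost is 2p. Over L = log N rounds this adds up to at most (4L + 2K - 2)p,
the stated constant. -/

theorem RankedAbove.trans {N : ℕ} {score : Fin N → ℝ} {a b c : Fin N}
    (hab : RankedAbove score a b) (hbc : RankedAbove score b c) : RankedAbove score a c := by
  unfold RankedAbove at *
  rcases hab with h | ⟨h, h'⟩ <;> rcases hbc with g | ⟨g, g'⟩
  · exact Or.inl (g.trans h)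
  · exact Or.inl (g ▸ h)
  · exact Or.inl (h ▸ g)
  · exact Or.inr ⟨h.trans g, h'.trans g'⟩

theorem not_rankedAbove_self {N : ℕ} (score : Fin N → ℝ) (a : Fin N) :
    ¬ RankedAbove score a a := by
  simp [RankedAbove]

theorem rankedAbove_or_rankedAbove {N : ℕ} (score : Fin N → ℝ) {a b : Fin N} (h : a ≠ b) :
    RankedAbove score a b ∨ RankedAbove score b a := by
  unfold RankedAbove
  rcases lt_trichotomy (score a) (score b) with h1 | h1 | h1
  · exact Or.inr (Or.inl h1)
  · rcases lt_or_gt_of_ne h with h2 | h2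
    · exact Or.inl (Or.inr ⟨h1, h2⟩)
    · exact Or.inr (Or.inr ⟨h1.symm, h2⟩)
  · exact Or.inl (Or.inl h1)

theorem RankedAbove.le {N : ℕ} {score : Fin N → ℝ} {a b : Fin N}
    (h : RankedAbove score a b) : score b ≤ score a := by
  rcases h with h | h
  · exact h.le
  · exact h.1.ge

-- The tie-break makes the ranking a strict total order, so counting the beams ranked above is a
-- bijection from S onto {0, …, |S| - 1}, and exactly |S| / 2 of these values lie below |S| / 2.
open Classical in
theorem card_topHalf {N : ℕ} (score : Fin N → ℝ) (S : Finset (Fin N)) :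
    (topHalf score S).card = S.card / 2 := by
  set f : Fin N → ℕ := fun i => (S.filter (fun j => RankedAbove score j i)).card with hf
  have hlt : ∀ i ∈ S, ∀ j ∈ S, RankedAbove score i j → f i < f j := by
    intro i hi j hj hij
    refine Finset.card_lt_card ((Finset.ssubset_iff_of_subset ?_).2 ⟨i, ?_, ?_⟩)
    · intro a ha
      simp only [Finset.mem_filter] at ha ⊢
      exact ⟨ha.1, ha.2.trans hij⟩
    · simp [hi, hij]
    · simp [not_rankedAbove_self]
  have hinj : Set.InjOn f S := by
    intro i hi j hj hij
    by_contra hne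
    rcases rankedAbove_or_rankedAbove score hne with h | h
    · exact (hlt i hi j hj h).ne hij
    · exact (hlt j hj i hi h).ne hij.symm
  have himg : S.image f = Finset.range S.card := by
    refine Finset.eq_of_subset_of_card_le ?_ ?_
    · intro a ha
      obtain ⟨i, hi, rfl⟩ := Finset.mem_image.1 ha
      rw [Finset.mem_range]
      refine Finset.card_lt_card (Finset.filter_ssubset.2 ⟨i, hi, not_rankedAbove_self _ _⟩)
    · rw [Finset.card_range, Finset.card_image_of_injOn hinj]
  have h1 : ((topHalf score S).image f) = Finset.range (S.card / 2) := by
    ext a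
    simp only [topHalf, Finset.mem_image, Finset.mem_filter, Finset.mem_range]
    constructor
    · rintro ⟨i, ⟨-, hi⟩, rfl⟩
      exact hi
    · intro ha
      have : a ∈ S.image f := by
        rw [himg, Finset.mem_range]; omega
      obtain ⟨i, hi, rfl⟩ := Finset.mem_image.1 this
      exact ⟨i, ⟨hi, ha⟩, rfl⟩
  rw [← Finset.card_range (S.card / 2), ← h1, Finset.card_image_of_injOn]
  exact hinj.mono (by intro i hi; exact (Finset.mem_filter.1 hi).1)

theorem topHalf_congr {N : ℕ} {s s' : Fin N → ℝ} {S : Finset (Fin N)}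
    (h : ∀ i ∈ S, s i = s' i) : topHalf s S = topHalf s' S := by
  classical
  unfold topHalf
  refine Finset.filter_congr fun i hi => ?_
  have : (S.filter (fun j => RankedAbove s j i)) = S.filter (fun j => RankedAbove s' j i) :=
    Finset.filter_congr fun j hj => by unfold RankedAbove; rw [h i hi, h j hj]
  rw [this]

/-- A beam of `S` outside the top half has at least `|S| / 2` rivals with at least its score. -/
theorem card_le_of_notMem_topHalf {N : ℕ} {score : Fin N → ℝ} {S : Finset (Fin N)} {k : Fin N}
    (hk : k ∈ S) (hk' : k ∉ topHalf score S) :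
    S.card / 2 ≤ ((S.erase k).filter (fun j => score k ≤ score j)).card := by
  classical
  have h : ¬ (S.filter (fun j => RankedAbove score j k)).card < S.card / 2 := by
    intro h
    exact hk' (Finset.mem_filter.2 ⟨hk, by convert h⟩)
  refine (not_lt.1 h).trans (Finset.card_le_card fun j hj => ?_)
  simp only [Finset.mem_filter, Finset.mem_erase] at hj ⊢
  refine ⟨⟨?_, hj.1⟩, hj.2.le⟩
  rintro rfl
  exact not_rankedAbove_self _ _ hj.2

theorem card_survivors {N : ℕ} (T : ℕ) (x : Fin N → ℕ → ℝ) (q : ℕ) :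
    (survivors T x q).card = N / 2 ^ q := by
  induction q with
  | zero => simp [survivors]
  | succ q ih => rw [survivors, card_topHalf, ih, Nat.div_div_eq_div_mul, pow_succ]

/-! ### Slots -/

theorem roundEnd_succ (N T q : ℕ) :
    roundEnd N T (q + 1) = roundEnd N T q + N / 2 ^ q * samples N T (q + 1) := by
  rw [roundEnd, roundEnd, Finset.sum_Icc_succ_top (by omega)]
  simp

theorem roundEnd_mono (N T : ℕ) : Monotone (roundEnd N T) :=
  monotone_nat_of_le_succ fun q => by rw [roundEnd_succ]; omega

theorem position_lt_card {N : ℕ} {S : Finset (Fin N)} {i : Fin N} (hi : i ∈ S) :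
    position S i < S.card :=
  Finset.card_lt_card (Finset.filter_ssubset.2 ⟨i, hi, lt_irrefl _⟩)

/-- Sample j is taken in the j-th cycle of |S| slots, and the round consists of exactly `samples`
such cycles. -/
theorem slot_mem {N T q : ℕ} {S : Finset (Fin N)} (hS : S.card = N / 2 ^ q) {i : Fin N}
    (hi : i ∈ S) {j : ℕ} (hj : j < samples N T (q + 1)) :
    slot T (q + 1) S i j ∈ Finset.Ioc (roundEnd N T q) (roundEnd N T (q + 1)) := by
  have h1 := position_lt_card hi
  have h2 : S.card * (j + 1) ≤ S.card * samples N T (q + 1) := Nat.mul_le_mul_left _ hj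
  rw [Finset.mem_Ioc, slot, roundEnd_succ, ← hS, Nat.add_sub_cancel]
  rw [Nat.mul_succ] at h2
  omega

theorem slot_injective {N T r : ℕ} {S : Finset (Fin N)} {i : Fin N} (hi : i ∈ S) :
    Function.Injective (slot T r S i) := by
  intro a b h
  have h1 : 0 < S.card := Finset.card_pos.2 ⟨i, hi⟩
  simp only [slot] at h
  exact Nat.eq_of_mul_eq_mul_left h1 (by omega)

/-- The survivors of `q` rounds depend only on the rewards in the slots of these rounds. -/
theorem survivors_congr {N T q : ℕ} {x y : Fin N → ℕ → ℝ}
    (h : ∀ i, ∀ t ∈ Finset.Ioc 0 (roundEnd N T q), x i t = y i t) :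
    survivors T x q = survivors T y q := by
  induction q with
  | zero => rfl
  | succ q ih =>
    have ih' := ih fun i t ht => h i t (by
      have := roundEnd_mono N T q.le_succ
      simp only [Finset.mem_Ioc] at ht ⊢
      exact ⟨ht.1, ht.2.trans this⟩)
    rw [survivors, survivors, ← ih']
    refine topHalf_congr fun i hi => ?_
    unfold sampleMean
    congr 1
    refine Finset.sum_congr rfl fun j hj => h i _ ?_
    have := slot_mem (card_survivors T x q) hi (Finset.mem_range.1 hj)
    simp only [Finset.mem_Ioc] at this ⊢
    exact ⟨by omega, this.2⟩

/-! ### Measurability -/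

theorem measurable_sampleMean {N : ℕ} (T r : ℕ) (S : Finset (Fin N)) (i : Fin N) :
    Measurable fun x : Fin N → ℕ → ℝ => sampleMean T r x S i := by
  unfold sampleMean
  fun_prop

theorem measurableSet_mem_topHalf {N : ℕ} {α : Type*} [MeasurableSpace α] {s : α → Fin N → ℝ}
    (hs : ∀ i, Measurable fun x => s x i) (S : Finset (Fin N)) (i : Fin N) :
    MeasurableSet {x | i ∈ topHalf (s x) S} := by
  classical
  have hA : ∀ j, MeasurableSet {x | RankedAbove (s x) j i} := fun j =>
    (measurableSet_lt (hs i) (hs j)).union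
      ((measurableSet_eq_fun (hs j) (hs i)).inter (MeasurableSet.const _))
  have hf : Measurable fun x => (S.filter (fun j => RankedAbove (s x) j i)).card := by
    simp_rw [Finset.card_filter]
    exact Finset.measurable_sum _ fun j _ =>
      Measurable.ite (hA j) measurable_const measurable_const
  have : {x | i ∈ topHalf (s x) S} =
      {x | i ∈ S ∧ (S.filter (fun j => RankedAbove (s x) j i)).card < S.card / 2} := by
    ext x
    simp only [topHalf, Finset.mem_filter, Set.mem_ofPred_eq]
  rw [this]
  exact (MeasurableSet.const _).inter (measurableSet_lt hf measurable_const)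

/-- The slots read in a round depend on the entrants. Partitioning over the finitely many possible
sets of entrants makes the slots deterministic, and with them the scores measurable. -/
theorem measurableSet_survivors_eq {N : ℕ} (T q : ℕ) (S : Finset (Fin N)) :
    MeasurableSet {x : Fin N → ℕ → ℝ | survivors T x q = S} := by
  induction q generalizing S with
  | zero =>
    simp only [survivors]
    exact MeasurableSet.const _
  | succ q ih =>
    have : {x : Fin N → ℕ → ℝ | survivors T x (q + 1) = S} =
        ⋃ S', {x | survivors T x q = S'} ∩
          ⋂ i, {x | i ∈ topHalf (sampleMean T (q + 1) x S') S' ↔ i ∈ S} := by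
      ext x
      simp [survivors, Finset.ext_iff (s₂ := S)]
    rw [this]
    refine MeasurableSet.iUnion fun S' => (ih S').inter (MeasurableSet.iInter fun i => ?_)
    have h := measurableSet_mem_topHalf (fun i => measurable_sampleMean T (q + 1) S' i) S' i
    by_cases hi : i ∈ S
    · simpa [hi] using h
    · simp only [hi, iff_false]
      exact h.compl

/-! ### Concentration within a round -/

/-- Variances scale with the means and may vanish; relaxing each to a common proxy `c` lets all
rewards share the constant σ²_max. -/
theorem hasSubgaussianMGF_of_map_eq_gaussianReal {Ω : Type*} [MeasurableSpace Ω] {Q : Measure Ω}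
    {X : Ω → ℝ} {m : ℝ} {v c : NNReal} (hX : Q.map X = gaussianReal m v) (hvc : v ≤ c) :
    HasSubgaussianMGF (fun ω => X ω - m) c Q := by
  have hXm : AEMeasurable X Q := aemeasurable_of_map_neZero (by rw [hX]; infer_instance)
  have hrw : ∀ t : ℝ, (fun ω => Real.exp (t * (X ω - m))) =
      fun ω => Real.exp (t * X ω) * Real.exp (-(t * m)) := fun t => by
    funext ω
    rw [← Real.exp_add]
    ring_nf
  refine ⟨fun t => ?_, fun t => ?_⟩
  · rw [hrw]
    refine Integrable.mul_const ?_ _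
    have h := integrable_exp_mul_gaussianReal (μ := m) (v := v) t
    rw [← hX] at h
    exact (integrable_map_measure (by fun_prop) hXm).1 h
  · have h := mgf_gaussianReal hX t
    rw [mgf] at h ⊢
    rw [hrw, integral_mul_const, h, ← Real.exp_add, Real.exp_le_exp]
    have : (v : ℝ) * t ^ 2 ≤ c * t ^ 2 := by
      gcongr
    linarith

/-- Markov's inequality for the number of events that occur within a given event `A`. -/
theorem mul_measureReal_inter_le_sum {Ω ι : Type*} [MeasurableSpace Ω] {Q : Measure Ω}
    [IsFiniteMeasure Q] {A : Set Ω} (W : Finset ι) {E : ι → Set Ω}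
    (hE : ∀ i, MeasurableSet (E i)) [∀ ω, DecidablePred fun i => ω ∈ E i] (d : ℕ) :
    (d : ℝ) * Q.real (A ∩ {ω | d ≤ (W.filter (fun i => ω ∈ E i)).card}) ≤
      ∑ i ∈ W, Q.real (A ∩ E i) := by
  have hcard : ∀ ω, ((W.filter (fun i => ω ∈ E i)).card : ENNReal) =
      ∑ i ∈ W, (E i).indicator 1 ω := fun ω => by
    rw [Finset.card_filter]
    push_cast
    refine Finset.sum_congr rfl fun i _ => ?_
    by_cases h : ω ∈ E i <;> simp [h]
  have hmeas : Measurable fun ω => ∑ i ∈ W, (E i).indicator (1 : Ω → ENNReal) ω :=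
    Finset.measurable_sum _ fun i _ => measurable_one.indicator (hE i)
  have h := mul_meas_ge_le_lintegral (μ := Q.restrict A) hmeas (d : ENNReal)
  rw [lintegral_finsetSum _ fun i _ => measurable_one.indicator (hE i)] at h
  simp_rw [lintegral_indicator_one (hE _), ← hcard, Nat.cast_le] at h
  rw [Measure.restrict_apply] at h
  swap
  · have h2 := measurableSet_le (measurable_const (a := (d : ENNReal))) hmeas
    simpa only [← hcard, Nat.cast_le] using h2
  have h' := ENNReal.toReal_mono (by simp) h
  rw [ENNReal.toReal_mul, ENNReal.toReal_sum (by simp)] at h'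
  simp_rw [Measure.restrict_apply (hE _)] at h'
  simpa only [Measure.real, ENNReal.toReal_natCast, Set.inter_comm A] using h'

section Model

variable {Ω : Type*} [MeasurableSpace Ω] {Q : Measure Ω} {N T : ℕ}
  {R : Fin N → ℕ → Ω → ℝ}

/-- A beam `i` that is worse than `k` by `Δ` throughout a round has at least the total reward
of `k` in this round with exponentially small probability. -/
theorem measureReal_sum_le_sum_le_exp [IsProbabilityMeasure Q]
    (hind : iIndepFun (fun (p : Fin N × Finset.Icc 1 T) => R p.1 p.2) Q)
    {m : Fin N → ℕ → ℝ} {c : NNReal}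
    (hsub : ∀ i, ∀ t ∈ Finset.Icc 1 T, HasSubgaussianMGF (fun ω => R i t ω - m i t) c Q)
    {q : ℕ} (hT : roundEnd N T (q + 1) ≤ T) {S : Finset (Fin N)} (hS : S.card = N / 2 ^ q)
    {i k : Fin N} (hi : i ∈ S) (hk : k ∈ S) (hik : i ≠ k) {Δ : ℝ} (hΔ : 0 ≤ Δ)
    (hm : ∀ t ∈ Finset.Ioc (roundEnd N T q) (roundEnd N T (q + 1)),
      ∀ t' ∈ Finset.Ioc (roundEnd N T q) (roundEnd N T (q + 1)), m i t + Δ ≤ m k t') :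
    Q.real {ω | ∑ j ∈ Finset.range (samples N T (q + 1)), R k (slot T (q + 1) S k j) ω ≤
        ∑ j ∈ Finset.range (samples N T (q + 1)), R i (slot T (q + 1) S i j) ω} ≤
      Real.exp (-(samples N T (q + 1) * Δ ^ 2) / (4 * c)) := by
  set n := samples N T (q + 1) with hn
  have hmem : ∀ a ∈ S, ∀ j : Fin n, slot T (q + 1) S a j ∈ Finset.Icc 1 T := by
    intro a ha j
    have := slot_mem hS ha j.2
    rw [Finset.mem_Ioc] at this
    rw [Finset.mem_Icc]
    omega
  -- The 2n samples of `i` and `k` are distinct (beam, slot) pairs, hence an independent subfamily.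
  -- The signs in `f` turn the event into: a centred sum of 2n terms is at least nΔ.
  let g : Fin n ⊕ Fin n → Fin N × Finset.Icc 1 T :=
    Sum.elim (fun j => (i, ⟨slot T (q + 1) S i j, hmem i hi j⟩))
      (fun j => (k, ⟨slot T (q + 1) S k j, hmem k hk j⟩))
  have hg : Function.Injective g := by
    rintro (a | a) (b | b) h
    · simp only [g, Sum.elim_inl, Prod.mk.injEq, Subtype.mk.injEq, true_and] at h
      exact congrArg _ (Fin.ext (slot_injective hi h))
    · exact absurd (congrArg Prod.fst h) hik
    · exact absurd (congrArg Prod.fst h) hik.symm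
    · simp only [g, Sum.elim_inr, Prod.mk.injEq, Subtype.mk.injEq, true_and] at h
      exact congrArg _ (Fin.ext (slot_injective hk h))
  let f : Fin n ⊕ Fin n → ℝ → ℝ :=
    Sum.elim (fun j y => y - m i (slot T (q + 1) S i j))
      (fun j y => -(y - m k (slot T (q + 1) S k j)))
  have hf : ∀ a, Measurable (f a) := by
    rintro (a | a)
    · simp only [f, Sum.elim_inl]; fun_prop
    · simp only [f, Sum.elim_inr]; fun_prop
  have hI := (hind.precomp hg).comp f hf
  have hsubG : ∀ a ∈ (Finset.univ : Finset (Fin n ⊕ Fin n)),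
      HasSubgaussianMGF (f a ∘ R (g a).1 (g a).2) c Q := by
    rintro (a | a) -
    · exact hsub i _ (hmem i hi a)
    · exact (hsub k _ (hmem k hk a)).neg
  have h := HasSubgaussianMGF.measure_sum_ge_le_of_iIndepFun hI hsubG
    (ε := n * Δ) (by positivity)
  refine le_trans (measureReal_mono ?_) (h.trans_eq ?_)
  · intro ω hω
    simp only [Set.mem_ofPred_eq, Finset.sum_range] at hω ⊢
    simp only [Fintype.sum_sum_type, f, g, Sum.elim_inl, Sum.elim_inr, Function.comp_apply,
      Finset.sum_neg_distrib, Finset.sum_sub_distrib]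
    have : ∑ j : Fin n, (m i (slot T (q + 1) S i j) + Δ) ≤
        ∑ j : Fin n, m k (slot T (q + 1) S k j) :=
      Finset.sum_le_sum fun j _ => hm _ (slot_mem hS hi j.2) _ (slot_mem hS hk j.2)
    simp only [Finset.sum_add_distrib, Finset.sum_const, Finset.card_univ, Fintype.card_fin,
      nsmul_eq_mul] at this
    linarith
  -- The exponent is (nΔ)² / (2 · 2n · c). For n = 0 or c = 0 both sides are exp 0, by division by
  -- zero.
  · congr 1
    simp only [Finset.sum_const, Finset.card_univ, Fintype.card_sum, Fintype.card_fin,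
      nsmul_eq_mul]
    push_cast
    rcases Nat.eq_zero_or_pos n with h0 | h0
    · simp [h0]
    rcases eq_or_ne (c : ℝ) 0 with hc | hc
    · simp [hc]
    have : (n : ℝ) ≠ 0 := by positivity
    field_simp
    ring

/-- The survivors of `q` rounds are independent of the rewards of the next round. -/
theorem measureReal_survivors_inter
    (hmeas : ∀ i, ∀ t ∈ Finset.Icc 1 T, Measurable (R i t))
    (hind : iIndepFun (fun (p : Fin N × Finset.Icc 1 T) => R p.1 p.2) Q)
    {q : ℕ} (hT : roundEnd N T (q + 1) ≤ T) {S : Finset (Fin N)} (hS : S.card = N / 2 ^ q)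
    {i k : Fin N} (hi : i ∈ S) (hk : k ∈ S) :
    Q.real ({ω | survivors T (fun i t => R i t ω) q = S} ∩
        {ω | ∑ j ∈ Finset.range (samples N T (q + 1)), R k (slot T (q + 1) S k j) ω ≤
          ∑ j ∈ Finset.range (samples N T (q + 1)), R i (slot T (q + 1) S i j) ω}) =
      Q.real {ω | survivors T (fun i t => R i t ω) q = S} *
        Q.real {ω | ∑ j ∈ Finset.range (samples N T (q + 1)), R k (slot T (q + 1) S k j) ω ≤
          ∑ j ∈ Finset.range (samples N T (q + 1)), R i (slot T (q + 1) S i j) ω} := by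
  classical
  have hq : roundEnd N T q ≤ T := (roundEnd_mono N T q.le_succ).trans hT
  let A : Finset (Fin N × Finset.Icc 1 T) := Finset.univ.filter fun p => p.2 ≤ roundEnd N T q
  let B : Finset (Fin N × Finset.Icc 1 T) := Finset.univ.filter fun p => ¬ p.2 ≤ roundEnd N T q
  have hAB : Disjoint A B := Finset.disjoint_filter_filter_not _ _ _
  have hI := hind.indepFun_finset A B hAB fun p => hmeas p.1 p.2 p.2.2
  -- Padding with zeros turns a table on the coordinates `C` into a full one, so both events become
  -- preimages under functions of the disjoint blocks `A` (past) and `B` (future).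
  let ext (C : Finset (Fin N × Finset.Icc 1 T)) (y : C → ℝ) (a : Fin N) (t : ℕ) : ℝ :=
    if h : ∃ ht : t ∈ Finset.Icc 1 T, (a, ⟨t, ht⟩) ∈ C then y ⟨(a, ⟨t, h.1⟩), h.2⟩ else 0
  have hext : ∀ C, Measurable (ext C) := by
    intro C
    refine measurable_pi_iff.2 fun a => measurable_pi_iff.2 fun t => ?_
    by_cases h : ∃ ht : t ∈ Finset.Icc 1 T, (a, ⟨t, ht⟩) ∈ C
    · simp only [ext, h, dif_pos]
      fun_prop
    · simp only [ext, h, dif_neg, not_false_eq_true]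
      fun_prop
  have h1 := (hext A) (measurableSet_survivors_eq T q S)
  have h2 : MeasurableSet (ext B ⁻¹' {x | ∑ j ∈ Finset.range (samples N T (q + 1)),
      x k (slot T (q + 1) S k j) ≤
        ∑ j ∈ Finset.range (samples N T (q + 1)), x i (slot T (q + 1) S i j)}) :=
    hext B (measurableSet_le (by fun_prop) (by fun_prop))
  have h := hI.measure_inter_preimage_eq_mul _ _ h1 h2
  have e1 : (fun ω (p : A) => R p.1.1 p.1.2 ω) ⁻¹' (ext A ⁻¹' {x | survivors T x q = S}) =
      {ω | survivors T (fun i t => R i t ω) q = S} := by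
    ext ω
    simp only [Set.mem_preimage, Set.mem_ofPred_eq]
    rw [survivors_congr (y := fun i t => R i t ω)]
    intro a t ht
    rw [Finset.mem_Ioc] at ht
    have : ∃ h : t ∈ Finset.Icc 1 T, (a, ⟨t, h⟩) ∈ A :=
      ⟨Finset.mem_Icc.2 (by omega), by simp [A, ht.2]⟩
    simp only [ext, this, dif_pos]
  have e2 : ∀ ω, ∀ a ∈ S, ∀ j ∈ Finset.range (samples N T (q + 1)),
      ext B (fun p => R p.1.1 p.1.2 ω) a (slot T (q + 1) S a j) =
        R a (slot T (q + 1) S a j) ω := by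
    intro ω a ha j hj
    have ht := slot_mem hS ha (Finset.mem_range.1 hj)
    rw [Finset.mem_Ioc] at ht
    have : ∃ h : slot T (q + 1) S a j ∈ Finset.Icc 1 T, (a, ⟨_, h⟩) ∈ B :=
      ⟨Finset.mem_Icc.2 (by omega), by simp [B, ht.1]⟩
    simp only [ext, this, dif_pos]
  have e3 : (fun ω (p : B) => R p.1.1 p.1.2 ω) ⁻¹' (ext B ⁻¹'
      {x | ∑ j ∈ Finset.range (samples N T (q + 1)), x k (slot T (q + 1) S k j) ≤
        ∑ j ∈ Finset.range (samples N T (q + 1)), x i (slot T (q + 1) S i j)}) =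
      {ω | ∑ j ∈ Finset.range (samples N T (q + 1)), R k (slot T (q + 1) S k j) ω ≤
        ∑ j ∈ Finset.range (samples N T (q + 1)), R i (slot T (q + 1) S i j) ω} := by
    ext ω
    simp only [Set.mem_preimage, Set.mem_ofPred_eq]
    rw [Finset.sum_congr rfl (e2 ω k hk), Finset.sum_congr rfl (e2 ω i hi)]
  rw [e1, e3] at h
  simp only [Measure.real, h, ENNReal.toReal_mul]

/-- Rewards are measurable only in slots 1, …, T; zeroing the others does not affect the survivors.
-/
theorem measurableSet_survivors (hmeas : ∀ i, ∀ t ∈ Finset.Icc 1 T, Measurable (R i t))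
    {q : ℕ} (hT : roundEnd N T q ≤ T) (S : Finset (Fin N)) :
    MeasurableSet {ω | survivors T (fun i t => R i t ω) q = S} := by
  have h : Measurable fun ω (a : Fin N) t => if t ∈ Finset.Icc 1 T then R a t ω else 0 := by
    refine measurable_pi_iff.2 fun a => measurable_pi_iff.2 fun t => ?_
    by_cases ht : t ∈ Finset.Icc 1 T
    · simpa only [ht, if_true] using hmeas a t ht
    · simp only [ht, if_false]
      fun_prop
  have h' : ∀ ω, survivors T (fun a t => if t ∈ Finset.Icc 1 T then R a t ω else 0) q =
      survivors T (fun i t => R i t ω) q := fun ω => survivors_congr fun a t ht => by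
    rw [Finset.mem_Ioc] at ht
    exact if_pos (Finset.mem_Icc.2 (by omega))
  simpa only [Set.preimage_ofPred_eq, h'] using h (measurableSet_survivors_eq T q S)

/-- If all but `b < h` of the rivals of `k` are worse than `k` by `Δ` throughout a round that
`2 h` beams enter, then `k` is eliminated in this round with small probability. -/
theorem mul_measureReal_eliminated_le [IsProbabilityMeasure Q]
    (hmeas : ∀ i, ∀ t ∈ Finset.Icc 1 T, Measurable (R i t))
    (hind : iIndepFun (fun (p : Fin N × Finset.Icc 1 T) => R p.1 p.2) Q)
    {m : Fin N → ℕ → ℝ} {c : NNReal}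
    (hsub : ∀ i, ∀ t ∈ Finset.Icc 1 T, HasSubgaussianMGF (fun ω => R i t ω - m i t) c Q)
    {q h : ℕ} (hT : roundEnd N T (q + 1) ≤ T) (hh : N / 2 ^ q = 2 * h)
    {k : Fin N} {Δ : ℝ} (hΔ : 0 ≤ Δ) (B : Finset (Fin N)) (hB : B.card < h)
    (hm : ∀ i, i ≠ k → i ∉ B → ∀ t ∈ Finset.Ioc (roundEnd N T q) (roundEnd N T (q + 1)),
      ∀ t' ∈ Finset.Ioc (roundEnd N T q) (roundEnd N T (q + 1)), m i t + Δ ≤ m k t') :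
    ((h : ℝ) - B.card) * Q.real {ω | k ∈ survivors T (fun i t => R i t ω) q ∧
        k ∉ survivors T (fun i t => R i t ω) (q + 1)} ≤
      2 * h * Real.exp (-(samples N T (q + 1) * Δ ^ 2) / (4 * c)) := by
  classical
  set p := Real.exp (-(samples N T (q + 1) * Δ ^ 2) / (4 * c)) with hp
  have hp0 : 0 ≤ p := (Real.exp_pos _).le
  let A (S : Finset (Fin N)) : Set Ω := {ω | survivors T (fun i t => R i t ω) q = S}
  let E (S : Finset (Fin N)) (i : Fin N) : Set Ω :=
    {ω | ∑ j ∈ Finset.range (samples N T (q + 1)), R k (slot T (q + 1) S k j) ω ≤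
      ∑ j ∈ Finset.range (samples N T (q + 1)), R i (slot T (q + 1) S i j) ω}
  -- The subtraction is in ℕ, but it is not truncated because `B.card < h`.
  let F (S : Finset (Fin N)) : Set Ω :=
    {ω | h - B.card ≤ (((S.erase k) \ B).filter (fun i => ω ∈ E S i)).card}
  let I : Finset (Finset (Fin N)) := Finset.univ.filter fun S => S.card = 2 * h ∧ k ∈ S
  have hcover : {ω | k ∈ survivors T (fun i t => R i t ω) q ∧
      k ∉ survivors T (fun i t => R i t ω) (q + 1)} ⊆ ⋃ S ∈ I, A S ∩ F S := by
    rintro ω ⟨h1, h2⟩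
    set S := survivors T (fun i t => R i t ω) q with hS
    have hcard : S.card = 2 * h := by rw [hS, card_survivors, hh]
    refine Set.mem_biUnion (x := S) (by simp [I, hcard, h1]) ⟨hS.symm, ?_⟩
    rw [survivors, ← hS] at h2
    have h3 := card_le_of_notMem_topHalf h1 h2
    rw [hcard, Nat.mul_div_cancel_left _ two_pos] at h3
    have h4 : (S.erase k).filter (fun j => sampleMean T (q + 1) (fun i t => R i t ω) S k ≤
        sampleMean T (q + 1) (fun i t => R i t ω) S j) ⊆
        ((S.erase k) \ B).filter (fun i => ω ∈ E S i) ∪ B := by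
      intro j hj
      rw [Finset.mem_filter] at hj
      by_cases hjB : j ∈ B
      · exact Finset.mem_union_right _ hjB
      refine Finset.mem_union_left _ (Finset.mem_filter.2 ⟨Finset.mem_sdiff.2 ⟨hj.1, hjB⟩, ?_⟩)
      have h5 := hj.2
      simp only [E, Set.mem_ofPred_eq]
      unfold sampleMean at h5
      rcases Nat.eq_zero_or_pos (samples N T (q + 1)) with h0 | h0
      · simp [h0]
      · exact (div_le_div_iff_of_pos_right (by exact_mod_cast h0)).1 h5
    have h6 := (Finset.card_le_card h4).trans (Finset.card_union_le _ _)
    simp only [F, Set.mem_ofPred_eq]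
    omega
  have hA : ∀ S, MeasurableSet (A S) :=
    measurableSet_survivors hmeas ((roundEnd_mono N T q.le_succ).trans hT)
  have hslot : ∀ S ∈ I, ∀ i ∈ S, ∀ j ∈ Finset.range (samples N T (q + 1)),
      slot T (q + 1) S i j ∈ Finset.Icc 1 T := by
    intro S hS i hi j hj
    have := slot_mem ((Finset.mem_filter.1 hS).2.1.trans hh.symm) hi (Finset.mem_range.1 hj)
    rw [Finset.mem_Ioc] at this
    exact Finset.mem_Icc.2 (by omega)
  have hround : ∀ S ∈ I, ((h : ℝ) - B.card) * Q.real (A S ∩ F S) ≤ 2 * h * p * Q.real (A S) := by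
    intro S hS
    obtain ⟨-, hcard, hk⟩ := Finset.mem_filter.1 hS
    -- For `i ∉ S` the formula for the slot may leave 1, …, T, where measurability is not known; the
    -- empty set replaces those events.
    let E' (i : Fin N) : Set Ω := if i ∈ S then E S i else ∅
    have hEE : ∀ i ∈ S, E' i = E S i := fun i hi => if_pos hi
    have hE : ∀ i, MeasurableSet (E' i) := by
      intro i
      by_cases hi : i ∈ S
      · rw [hEE i hi]
        exact measurableSet_le
          (Finset.measurable_sum _ fun j hj => hmeas _ _ (hslot S hS k hk j hj))
          (Finset.measurable_sum _ fun j hj => hmeas _ _ (hslot S hS i hi j hj))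
      · simp only [E', hi, if_false, MeasurableSet.empty]
    have hW : ∀ i ∈ (S.erase k) \ B, i ∈ S ∧ i ≠ k ∧ i ∉ B := by
      intro i hi
      rw [Finset.mem_sdiff, Finset.mem_erase] at hi
      exact ⟨hi.1.2, hi.1.1, hi.2⟩
    have hF : F S = {ω | h - B.card ≤ (((S.erase k) \ B).filter (fun i => ω ∈ E' i)).card} := by
      ext ω
      have : ((S.erase k) \ B).filter (fun i => ω ∈ E S i) =
          ((S.erase k) \ B).filter (fun i => ω ∈ E' i) :=
        Finset.filter_congr fun i hi => by rw [hEE i (hW i hi).1]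
      simp only [F, Set.mem_ofPred_eq, this]
    have h1 := mul_measureReal_inter_le_sum (Q := Q) (A := A S) ((S.erase k) \ B) hE (h - B.card)
    rw [← hF, Nat.cast_sub hB.le] at h1
    refine h1.trans ?_
    have h2 : ∀ i ∈ (S.erase k) \ B, Q.real (A S ∩ E' i) ≤ p * Q.real (A S) := by
      intro i hi
      obtain ⟨hiS, hik, hiB⟩ := hW i hi
      rw [hEE i hiS, mul_comm,
        measureReal_survivors_inter hmeas hind hT (hcard.trans hh.symm) hiS hk]
      exact mul_le_mul_of_nonneg_left (measureReal_sum_le_sum_le_exp hind hsub hT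
        (hcard.trans hh.symm) hiS hk hik hΔ (hm i hik hiB)) measureReal_nonneg
    refine (Finset.sum_le_card_nsmul _ _ _ h2).trans ?_
    rw [nsmul_eq_mul, mul_assoc]
    refine mul_le_mul_of_nonneg_right ?_ (by positivity)
    have : ((S.erase k) \ B).card ≤ 2 * h :=
      (Finset.card_le_card fun i hi => (hW i hi).1).trans_eq hcard
    exact_mod_cast this
  have hpos : (0 : ℝ) ≤ h - B.card := by
    rw [sub_nonneg]
    exact_mod_cast hB.le
  have hsum : ∑ S ∈ I, Q.real (A S) ≤ 1 := by
    rw [← measureReal_biUnion_finset ?_ fun S _ => hA S]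
    · exact measureReal_le_one
    · intro S _ S' _ hne
      exact Set.disjoint_left.2 fun ω h1 h2 => hne (h1.symm.trans h2)
  calc _ ≤ ((h : ℝ) - B.card) * ∑ S ∈ I, Q.real (A S ∩ F S) :=
        mul_le_mul_of_nonneg_left
          ((measureReal_mono hcover (measure_ne_top _ _)).trans
            (measureReal_biUnion_finset_le _ _)) hpos
    _ = ∑ S ∈ I, ((h : ℝ) - B.card) * Q.real (A S ∩ F S) := Finset.mul_sum _ _ _
    _ ≤ ∑ S ∈ I, 2 * h * p * Q.real (A S) := Finset.sum_le_sum hround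
    _ = 2 * h * p * ∑ S ∈ I, Q.real (A S) := (Finset.mul_sum _ _ _).symm
    _ ≤ 2 * h * p * 1 := mul_le_mul_of_nonneg_left hsum (by positivity)
    _ = 2 * h * p := mul_one _

end Model

/-! ### Round arithmetic -/

theorem samples_succ {N L m T : ℕ} (hN : N = 2 ^ L) (hL : 1 ≤ L) (hT : T = N * L * m) (q : ℕ) :
    samples N T (q + 1) = 2 ^ q * m := by
  have hlog : Nat.log 2 N = L := by rw [hN, Nat.log_pow one_lt_two]
  have hpos : 0 < N * L := Nat.mul_pos (hN ▸ by positivity) hL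
  rw [samples, hlog, hT, Nat.add_sub_cancel,
    show 2 ^ q * (N * L * m) = 2 ^ q * m * (N * L) by ring, Nat.mul_div_cancel _ hpos]

/-- The number of beams halves while the samples per beam double, so every round lasts N m slots. -/
theorem roundEnd_eq {N L m T : ℕ} (hN : N = 2 ^ L) (hL : 1 ≤ L) (hT : T = N * L * m) {r : ℕ}
    (hr : r ≤ L) : roundEnd N T r = r * (N * m) := by
  induction r with
  | zero => simp [roundEnd]
  | succ r ih =>
    have hd : N / 2 ^ r * 2 ^ r = N := Nat.div_mul_cancel (hN ▸ pow_dvd_pow 2 (by omega))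
    rw [roundEnd_succ, ih (by omega), samples_succ hN hL hT, ← mul_assoc (N / 2 ^ r), hd]
    ring

/-- This turns r* into a count: round q + 1 is at most r* exactly when half of its N / 2^q entrants
still number at least K (for N a power of two and q < log N). -/
theorem le_rStar_iff {N K : ℕ} (hN : 0 < N) (hK : 0 < K) (q : ℕ) :
    ((q + 1 : ℕ) : ℤ) ≤ rStar N K ↔ 2 * K * 2 ^ q ≤ N := by
  have hN' : (0 : ℝ) < N := by exact_mod_cast hN
  have hK' : (0 : ℝ) < K := by exact_mod_cast hK
  rw [rStar, Nat.cast_succ, add_le_add_iff_right, Int.le_floor,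
    Real.le_logb_iff_rpow_le one_lt_two (by positivity), le_div_iff₀ (by positivity)]
  push_cast
  rw [Real.rpow_natCast, mul_comm]
  exact_mod_cast Iff.rfl

theorem le_roundEnd_changeRound {N T s L : ℕ} (hL : 1 ≤ L) (hs : s ≤ roundEnd N T L) :
    1 ≤ changeRound N T s ∧ s ≤ roundEnd N T (changeRound N T s) ∧ changeRound N T s ≤ L := by
  have hmem : L ∈ {r | 1 ≤ r ∧ s ≤ roundEnd N T r} := ⟨hL, hs⟩
  have h := Nat.sInf_mem ⟨L, hmem⟩
  exact ⟨h.1, h.2, Nat.sInf_le hmem⟩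

/-! ### Gaps and variances -/

section Gaps

variable {N : ℕ} {μ : Fin N → ℝ} {k : Fin N} {μplus : ℝ}

theorem minGap_le (μ : Fin N → ℝ) {i j : Fin N} (h : i ≠ j) : minGap μ ≤ |μ i - μ j| :=
  ciInf_le (f := fun p : {p : Fin N × Fin N // p.1 ≠ p.2} => |μ p.1.1 - μ p.1.2|)
    (Set.finite_range _).bddBelow ⟨(i, j), h⟩

theorem minGap_nonneg (μ : Fin N → ℝ) : 0 ≤ minGap μ :=
  Real.iInf_nonneg fun _ => abs_nonneg _

theorem deltaMin_nonneg : 0 ≤ deltaMin μ k μplus :=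
  le_min (minGap_nonneg _) (minGap_nonneg _)

theorem add_deltaMin_le_before {i : Fin N} (hik : i ≠ k) (h : μ i ≤ μ k) :
    μ i + deltaMin μ k μplus ≤ μ k := by
  have h1 : deltaMin μ k μplus ≤ |μ i - μ k| := (min_le_left _ _).trans (minGap_le μ hik)
  rw [abs_sub_comm, abs_of_nonneg (sub_nonneg.2 h)] at h1
  linarith

theorem add_deltaMin_le_after {i : Fin N} (hik : i ≠ k) (h : μ i ≤ μplus) :
    μ i + deltaMin μ k μplus ≤ μplus := by
  have h1 : deltaMin μ k μplus ≤ |meanAfter μ k μplus i - meanAfter μ k μplus k| :=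
    (min_le_right _ _).trans (minGap_le _ hik)
  rw [meanAfter, Function.update_self, Function.update_of_ne hik, abs_sub_comm,
    abs_of_nonneg (sub_nonneg.2 h)] at h1
  linarith

theorem meanAt_of_ne {s t : ℕ} {i : Fin N} (hik : i ≠ k) : meanAt μ k μplus s t i = μ i := by
  simp [meanAt, meanAfter, hik]

theorem meanAt_self (s t : ℕ) : meanAt μ k μplus s t k = if t ≤ s then μ k else μplus := by
  simp [meanAt, meanAfter]

theorem meanAt_le_muMax (s t : ℕ) (i : Fin N) : meanAt μ k μplus s t i ≤ muMax μ k μplus := by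
  unfold meanAt muMax
  split_ifs
  · exact (le_ciSup (Set.finite_range μ).bddAbove i).trans (le_max_left _ _)
  · exact (le_ciSup (Set.finite_range (meanAfter μ k μplus)).bddAbove i).trans (le_max_right _ _)

theorem sigmaMaxSq_pos {σ : ℝ} (hσ : 0 < σ) (h : 0 < μplus) : 0 < sigmaMaxSq σ μ k μplus := by
  have h1 := meanAt_le_muMax (μ := μ) (k := k) (μplus := μplus) 0 1 k
  rw [meanAt_self, if_neg (by omega)] at h1
  have := h.trans_le h1
  unfold sigmaMaxSq
  positivity

end Gaps

/-! ### The error probability for an early change -/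

section Early

variable {Ω : Type*} [MeasurableSpace Ω] {P : Measure Ω} {N T : ℕ} {σ : ℝ} {μ : Fin N → ℝ}
  {k : Fin N} {μplus : ℝ} {tc : Ω → ℕ} {R : Fin N → ℕ → Ω → ℝ}

/-- With the change in an early round, `k` is eliminated in a given round with small
probability. -/
theorem measureReal_eliminated_le [IsFiniteMeasure P] {L m : ℕ} (hN : N = 2 ^ L) (hL : 1 ≤ L)
    (hT : T = N * L * m) (hσ : 0 < σ) (hμ : ∀ i, 0 ≤ μ i) (hbest : ∀ i, i ≠ k → μ i < μplus)
    (hmodel : IsChangeModel P T σ μ k μplus tc R) {s : ℕ} (hs : s ≤ T)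
    (hP : P (tc ⁻¹' {s}) ≠ 0)
    (hearly : (changeRound N T s : ℤ) ≤ rStar N (rank μ k)) {q : ℕ} (hq : q < L) :
    (cond P (tc ⁻¹' {s})).real {ω | k ∈ survivors T (fun i t => R i t ω) q ∧
        k ∉ survivors T (fun i t => R i t ω) (q + 1)} ≤
      (4 + if ((q + 1 : ℕ) : ℤ) = rStar N (rank μ k) then 2 * (rank μ k : ℝ) - 2 else 0) *
        Real.exp (-(m * deltaMin μ k μplus ^ 2) / (4 * sigmaMaxSq σ μ k μplus)) := by
  have : IsProbabilityMeasure (cond P (tc ⁻¹' {s})) := cond_isProbabilityMeasure hP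
  have hTL : roundEnd N T L = T := by rw [roundEnd_eq hN hL hT le_rfl, hT]; ring
  obtain ⟨hc1, hc2, hcL⟩ := le_roundEnd_changeRound hL (hs.trans_eq hTL.symm)
  have hN0 : 0 < N := hN ▸ by positivity
  have hK0 : 0 < rank μ k := Nat.succ_pos _
  set K := rank μ k with hK
  set Δ := deltaMin μ k μplus with hΔdef
  have hΔ : 0 ≤ Δ := deltaMin_nonneg
  obtain ⟨j, rfl⟩ : ∃ j, L = q + 1 + j := ⟨L - (q + 1), by omega⟩
  set h := 2 ^ j with hh
  have hNh : N = 2 * h * 2 ^ q := by rw [hN, hh]; ring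
  have hdiv : N / 2 ^ q = 2 * h := by rw [hNh, Nat.mul_div_cancel _ (by positivity)]
  have hh1 : 1 ≤ h := Nat.one_le_two_pow
  have hσ0 : 0 ≤ sigmaMaxSq σ μ k μplus := by
    have := (hμ k).trans
      ((le_ciSup (Set.finite_range μ).bddAbove k).trans (le_max_left _ (⨆ i, meanAfter μ k μplus i)))
    unfold sigmaMaxSq muMax
    positivity
  have hsub : ∀ i, ∀ t ∈ Finset.Icc 1 T,
      HasSubgaussianMGF (fun ω => R i t ω - meanAt μ k μplus s t i)
        (sigmaMaxSq σ μ k μplus).toNNReal (cond P (tc ⁻¹' {s})) := fun i t ht =>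
    hasSubgaussianMGF_of_map_eq_gaussianReal (hmodel.law s hP i t ht) (Real.toNNReal_mono
      (mul_le_mul_of_nonneg_left (meanAt_le_muMax s t i) (by positivity)))
  have hT' : roundEnd N T (q + 1) ≤ T := (roundEnd_mono N T hq).trans_eq hTL
  -- the beams that may be better than `k` in this round
  let B : Finset (Fin N) := if ((q + 1 : ℕ) : ℤ) ≤ rStar N K then
    Finset.univ.filter (fun i => μ k < μ i) else ∅
  have hm : ∀ i, i ≠ k → i ∉ B → ∀ t ∈ Finset.Ioc (roundEnd N T q) (roundEnd N T (q + 1)),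
      ∀ t' ∈ Finset.Ioc (roundEnd N T q) (roundEnd N T (q + 1)),
      meanAt μ k μplus s t i + Δ ≤ meanAt μ k μplus s t' k := by
    intro i hik hiB t _ t' ht'
    have hplus := add_deltaMin_le_after hik (hbest i hik).le
    rw [meanAt_of_ne hik, meanAt_self]
    split_ifs with hts
    · refine add_deltaMin_le_before hik ?_
      -- A slot of round q + 1 that is not after the change forces q + 1 ≤ r_c ≤ r*.
      have hle : ((q + 1 : ℕ) : ℤ) ≤ rStar N K := by
        refine le_trans ?_ hearly
        by_contra hlt
        have := roundEnd_mono N T (show changeRound N T s ≤ q by omega)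
        rw [Finset.mem_Ioc] at ht'
        omega
      have hBeq : B = Finset.univ.filter (fun i => μ k < μ i) := if_pos hle
      simpa [hBeq] using hiB
    · exact hplus
  have hBK : B.card ≤ K - 1 := by
    simp only [B]
    split_ifs
    · simp [hK, rank]
    · simp
  have hcases : B.card < h ∧ 2 * (h : ℝ) ≤ (4 + if ((q + 1 : ℕ) : ℤ) = rStar N K then
      2 * (K : ℝ) - 2 else 0) * (h - B.card) := by
    have hKr : (1 : ℝ) ≤ K := by exact_mod_cast hK0
    have hhr : (1 : ℝ) ≤ h := by exact_mod_cast hh1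
    rcases lt_trichotomy ((q + 1 : ℕ) : ℤ) (rStar N K) with hlt | heq | hgt
    · have h1 : 2 * K * 2 ^ (q + 1) ≤ N :=
        (le_rStar_iff hN0 hK0 (q + 1)).1 (by push_cast at *; omega)
      have h2 : 2 * K ≤ h := by
        refine Nat.le_of_mul_le_mul_right ?_ (show 0 < 2 ^ (q + 1) by positivity)
        rw [pow_succ] at *
        linarith
      have h3 : 2 * B.card ≤ h := by omega
      have h3' : 2 * (B.card : ℝ) ≤ h := by exact_mod_cast h3
      refine ⟨by omega, ?_⟩
      rw [if_neg hlt.ne]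
      linarith
    · have h1 : 2 * K * 2 ^ q ≤ N := (le_rStar_iff hN0 hK0 q).1 heq.le
      have h2 : K ≤ h := by
        refine Nat.le_of_mul_le_mul_right ?_ (show 0 < 2 * 2 ^ q by positivity)
        linarith
      have h3' : (B.card : ℝ) + 1 ≤ K := by
        have : B.card + 1 ≤ K := by omega
        exact_mod_cast this
      have h2' : (K : ℝ) ≤ h := by exact_mod_cast h2
      refine ⟨by omega, ?_⟩
      rw [if_pos heq]
      -- (K - 1)(h - K) ≥ 0 says h ≤ K(h - K + 1), whence 2h ≤ 2K(h - b).
      nlinarith [mul_nonneg (sub_nonneg.2 hKr) (sub_nonneg.2 h2')]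
    · have hB0 : B = ∅ := if_neg hgt.not_ge
      rw [hB0, if_neg hgt.ne', Finset.card_empty]
      refine ⟨hh1, ?_⟩
      push_cast
      linarith
  have hmain := mul_measureReal_eliminated_le hmodel.measurable_reward (hmodel.indep s hP) hsub hT'
    hdiv hΔ B hcases.1 hm
  rw [samples_succ hN hL hT, Real.coe_toNNReal _ hσ0] at hmain
  -- Sample sizes grow with the round, so the first round's m = T / (N L) serves for all.
  have hexp : Real.exp (-((2 ^ q * m : ℕ) * Δ ^ 2) / (4 * sigmaMaxSq σ μ k μplus)) ≤
      Real.exp (-(m * Δ ^ 2) / (4 * sigmaMaxSq σ μ k μplus)) := by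
    have h1 : (m : ℝ) ≤ (2 ^ q * m : ℕ) := by
      exact_mod_cast Nat.le_mul_of_pos_left m (by positivity)
    gcongr
  set e := Real.exp (-(m * Δ ^ 2) / (4 * sigmaMaxSq σ μ k μplus))
  have hpos : (0 : ℝ) < h - B.card := sub_pos.2 (by exact_mod_cast hcases.1)
  refine le_of_mul_le_mul_left (hmain.trans ?_) hpos
  calc 2 * (h : ℝ) * _ ≤ 2 * h * e := by gcongr
    _ ≤ _ * e := mul_le_mul_of_nonneg_right hcases.2 (Real.exp_pos _).le
    _ = _ := by ring

/-- With the change in an early round, `k` is selected with high probability. -/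
theorem measureReal_notMem_survivors_le [IsFiniteMeasure P] {L m : ℕ} (hN : N = 2 ^ L)
    (hL : 1 ≤ L)
    (hT : T = N * L * m) (hσ : 0 < σ) (hμ : ∀ i, 0 ≤ μ i) (hbest : ∀ i, i ≠ k → μ i < μplus)
    (hmodel : IsChangeModel P T σ μ k μplus tc R) {s : ℕ} (hs : s ≤ T)
    (hP : P (tc ⁻¹' {s}) ≠ 0)
    (hearly : (changeRound N T s : ℤ) ≤ rStar N (rank μ k)) :
    (cond P (tc ⁻¹' {s})).real {ω | k ∉ survivors T (fun i t => R i t ω) L} ≤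
      2 * (2 * L + rank μ k - 1) *
        Real.exp (-(m * deltaMin μ k μplus ^ 2) / (4 * sigmaMaxSq σ μ k μplus)) := by
  have : IsProbabilityMeasure (cond P (tc ⁻¹' {s})) := cond_isProbabilityMeasure hP
  set e := Real.exp (-(m * deltaMin μ k μplus ^ 2) / (4 * sigmaMaxSq σ μ k μplus))
  set K := rank μ k with hK
  have hK1 : (1 : ℝ) ≤ K := by exact_mod_cast (Nat.succ_pos _ : 0 < rank μ k)
  let f (q : ℕ) : ℝ := if ((q + 1 : ℕ) : ℤ) = rStar N K then 2 * (K : ℝ) - 2 else 0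
  have hsum : ∀ q ≤ L, (cond P (tc ⁻¹' {s})).real {ω | k ∉ survivors T (fun i t => R i t ω) q} ≤
      (∑ r ∈ Finset.range q, (4 + f r)) * e := by
    intro q
    induction q with
    | zero => simp [survivors]
    | succ q ih =>
      intro hq
      have h1 := measureReal_eliminated_le hN hL hT hσ hμ hbest hmodel hs hP hearly
        (show q < L from hq)
      have hsubset : {ω | k ∉ survivors T (fun i t => R i t ω) (q + 1)} ⊆
          {ω | k ∉ survivors T (fun i t => R i t ω) q} ∪
          {ω | k ∈ survivors T (fun i t => R i t ω) q ∧
            k ∉ survivors T (fun i t => R i t ω) (q + 1)} := fun ω hω =>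
        (em (k ∈ survivors T (fun i t => R i t ω) q)).elim (fun h => Or.inr ⟨h, hω⟩) Or.inl
      rw [Finset.sum_range_succ, add_mul]
      exact (measureReal_mono hsubset).trans
        ((measureReal_union_le _ _).trans (add_le_add (ih (by omega)) h1))
  have hf : ∑ r ∈ Finset.range L, f r ≤ 2 * K - 2 := by
    -- Only the round r* carries the extra term. The second conjunct excludes r* ≤ 0, where `toNat`
    -- would wrongly give 0.
    have h1 : ∀ r, f r = if r = (rStar N K - 1).toNat ∧ 1 ≤ rStar N K then 2 * (K : ℝ) - 2 else 0 :=
      fun r => if_congr (by omega) rfl rfl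
    have h2 : ∀ r, f r ≤ if r = (rStar N K - 1).toNat then 2 * (K : ℝ) - 2 else 0 := by
      intro r
      rw [h1]
      split_ifs with h3 h4 h4
      · exact le_rfl
      · exact absurd h3.1 h4
      · linarith
      · exact le_rfl
    refine (Finset.sum_le_sum fun r _ => h2 r).trans ?_
    rw [Finset.sum_ite_eq']
    split_ifs
    · exact le_rfl
    · linarith
  refine (hsum L le_rfl).trans (mul_le_mul_of_nonneg_right ?_ (Real.exp_pos _).le)
  rw [Finset.sum_add_distrib, Finset.sum_const, Finset.card_range, nsmul_eq_mul]
  linarith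

/-- After an early change, beam `k` has the largest mean in the last slot. -/
theorem meanAt_le_meanAt_self {L m : ℕ} (hN : N = 2 ^ L) (hL : 1 ≤ L)
    (hT : T = N * L * m) (hm : 0 < m) (hbest : ∀ i, i ≠ k → μ i < μplus) {s : ℕ} (hs : s ≤ T)
    (hearly : (changeRound N T s : ℤ) ≤ rStar N (rank μ k)) (i : Fin N) :
    meanAt μ k μplus s T i ≤ meanAt μ k μplus s T k := by
  rcases eq_or_ne i k with rfl | hik
  · exact le_rfl
  rw [meanAt_of_ne hik, meanAt_self]
  split_ifs with hTs
  -- A change at T never takes effect. It lies in round L, so being early means L ≤ r*, which forces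
  -- K = 1: beam `k` was already best.
  · obtain rfl : s = T := le_antisymm hs hTs
    have hN0 : 0 < N := hN ▸ by positivity
    have hsL : roundEnd N s L = s := by rw [roundEnd_eq hN hL hT le_rfl, hT]; ring
    obtain ⟨-, hc2, hcL⟩ := le_roundEnd_changeRound hL hsL.ge
    rw [roundEnd_eq hN hL hT hcL] at hc2
    have hLc : L ≤ changeRound N s s := by
      refine Nat.le_of_mul_le_mul_right ?_ (Nat.mul_pos hN0 hm)
      calc L * (N * m) = s := by rw [hT]; ring
        _ ≤ _ := hc2
    obtain ⟨l, rfl⟩ : ∃ l, L = l + 1 := ⟨L - 1, by omega⟩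
    have h1 := (le_rStar_iff hN0 (Nat.succ_pos _) l).1
      (le_trans (by exact_mod_cast hLc) hearly)
    have h2 : rank μ k ≤ 1 := by
      refine Nat.le_of_mul_le_mul_right ?_ hN0
      have h2 : N = 2 * 2 ^ l := hN.trans (by ring)
      calc rank μ k * N = rank μ k * (2 * 2 ^ l) := congrArg _ h2
        _ = 2 * rank μ k * 2 ^ l := by ring
        _ ≤ N := h1
        _ = 1 * N := (one_mul _).symm
    have h3 : Finset.univ.filter (fun i => μ k < μ i) = ∅ := by
      rw [← Finset.card_eq_zero]
      unfold rank at h2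
      omega
    exact not_lt.1 (Finset.filter_eq_empty_iff.1 h3 (Finset.mem_univ i))
  · exact (hbest i hik).le

/-- Total probability over the values of `tc`: the bound given `tc = s` is uniform in early s, and
values of probability zero, whose conditional law is unspecified, contribute nothing. -/
theorem measureReal_error_inter_early_le [IsProbabilityMeasure P] {L m : ℕ} (hN : N = 2 ^ L)
    (hL : 1 ≤ L) (hT : T = N * L * m) (hm : 0 < m) (hσ : 0 < σ) (hμ : ∀ i, 0 ≤ μ i)
    (hbest : ∀ i, i ≠ k → μ i < μplus) (hmodel : IsChangeModel P T σ μ k μplus tc R) :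
    P.real (errorEvent T μ k μplus tc R ∩ earlyChange N T (rank μ k) tc) ≤
      2 * (2 * L + rank μ k - 1) *
        Real.exp (-(m * deltaMin μ k μplus ^ 2) / (4 * sigmaMaxSq σ μ k μplus)) := by
  have hlog : Nat.log 2 N = L := by rw [hN, Nat.log_pow one_lt_two]
  set C := 2 * (2 * (L : ℝ) + rank μ k - 1) *
    Real.exp (-(m * deltaMin μ k μplus ^ 2) / (4 * sigmaMaxSq σ μ k μplus)) with hC
  have hC0 : 0 ≤ C := by
    have hK1 : (1 : ℝ) ≤ rank μ k := by exact_mod_cast (Nat.succ_pos _ : 0 < rank μ k)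
    have : (0 : ℝ) ≤ 2 * L + rank μ k - 1 := by
      have : (0 : ℝ) ≤ L := Nat.cast_nonneg _
      linarith
    positivity
  have hmeas : ∀ s, MeasurableSet (tc ⁻¹' {s}) := fun s =>
    hmodel.measurable_tc (measurableSet_singleton s)
  let I := (Finset.range (T + 1)).filter fun s => (changeRound N T s : ℤ) ≤ rStar N (rank μ k)
  have hcover : errorEvent T μ k μplus tc R ∩ earlyChange N T (rank μ k) tc ⊆
      ⋃ s ∈ I, tc ⁻¹' {s} ∩ {ω | k ∉ survivors T (fun i t => R i t ω) L} := by
    rintro ω ⟨herr, hearly⟩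
    have hs := hmodel.tc_le ω
    refine Set.mem_biUnion (x := tc ω)
      (Finset.mem_filter.2 ⟨Finset.mem_range.2 (by omega), hearly⟩) ⟨rfl, fun hk => herr ?_⟩
    refine ⟨k, ?_, meanAt_le_meanAt_self hN hL hT hm hbest hs hearly⟩
    have hcard := card_survivors T (fun i t => R i t ω) L
    rw [Nat.div_eq_of_eq_mul_left (by positivity) (hN.trans (one_mul _).symm)] at hcard
    obtain ⟨b, hb⟩ := Finset.card_eq_one.1 hcard
    rw [hb, Finset.mem_singleton] at hk
    rw [Selects, hlog, hb, hk]
  have hterm : ∀ s ∈ I, P.real (tc ⁻¹' {s} ∩ {ω | k ∉ survivors T (fun i t => R i t ω) L}) ≤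
      C * P.real (tc ⁻¹' {s}) := by
    intro s hs
    obtain ⟨hsT, hearly⟩ := Finset.mem_filter.1 hs
    rw [Finset.mem_range] at hsT
    rcases eq_or_ne (P (tc ⁻¹' {s})) 0 with h0 | h0
    · rw [measureReal_def, measureReal_def, measure_inter_null_of_null_left _ h0, h0]
      simp
    · rw [measureReal_def, ← cond_mul_eq_inter (hmeas s), ENNReal.toReal_mul]
      exact mul_le_mul_of_nonneg_right (measureReal_notMem_survivors_le hN hL hT hσ hμ hbest
        hmodel (by omega) h0 hearly) ENNReal.toReal_nonneg
  have hone : ∑ s ∈ I, P.real (tc ⁻¹' {s}) ≤ 1 := by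
    rw [← measureReal_biUnion_finset ?_ fun s _ => hmeas s]
    · exact measureReal_le_one
    · intro s _ s' _ hne
      exact Set.disjoint_left.2 fun ω h1 h2 => hne (h1.symm.trans h2)
  calc _ ≤ ∑ s ∈ I, P.real (tc ⁻¹' {s} ∩ {ω | k ∉ survivors T (fun i t => R i t ω) L}) :=
        (measureReal_mono hcover (measure_ne_top _ _)).trans (measureReal_biUnion_finset_le _ _)
    _ ≤ ∑ s ∈ I, C * P.real (tc ⁻¹' {s}) := Finset.sum_le_sum hterm
    _ = C * ∑ s ∈ I, P.real (tc ⁻¹' {s}) := (Finset.mul_sum _ _ _).symm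
    _ ≤ C * 1 := mul_le_mul_of_nonneg_left hone hC0
    _ = C := mul_one C

/-- The late term dominates the probability of a late change. -/
theorem measureReal_lateChange_le_lateTerm [IsProbabilityMeasure P] {K L : ℕ} (hN : N = 2 ^ L)
    (hL : 1 ≤ L) (htc : Measurable tc) (hle : ∀ ω, tc ω ≤ roundEnd N T L) :
    P.real (lateChange N T K tc) ≤ lateTerm P N T K tc ∧ 0 ≤ lateTerm P N T K tc := by
  have hlog : Nat.log 2 N = L := by rw [hN, Nat.log_pow one_lt_two]
  have hcL : ∀ ω, changeRound N T (tc ω) ≤ L := fun ω => (le_roundEnd_changeRound hL (hle ω)).2.2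
  set D : Set Ω := {ω | rStar N K ≤ (changeRound N T (tc ω) : ℤ) ∧
      changeRound N T (tc ω) ≤ Nat.log 2 N} with hD
  have hmc : Measurable fun ω => changeRound N T (tc ω) :=
    (measurable_from_nat (f := changeRound N T)).comp htc
  have hDm : MeasurableSet D :=
    hmc (t := {r : ℕ | rStar N K ≤ (r : ℤ) ∧ r ≤ Nat.log 2 N}) (MeasurableSet.of_discrete)
  have hlm : MeasurableSet (lateChange N T K tc) :=
    hmc (t := {r : ℕ | rStar N K < (r : ℤ)}) (MeasurableSet.of_discrete)
  have hsub : lateChange N T K tc ⊆ D := fun ω hω =>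
    ⟨le_of_lt hω, (hcL ω).trans_eq hlog.symm⟩
  have hint : Integrable (fun ω => (changeRound N T (tc ω) : ℝ) - (rStar N K : ℝ))
      (cond P D) := by
    refine Integrable.sub ?_ (integrable_const _)
    refine Integrable.of_bound (measurable_from_nat.comp hmc).aestronglyMeasurable (L : ℝ)
      (Filter.Eventually.of_forall fun ω => ?_)
    rw [Real.norm_of_nonneg (Nat.cast_nonneg _)]
    exact_mod_cast hcL ω
  have h1 : (cond P D).real (lateChange N T K tc) ≤ lateTerm P N T K tc := by
    rw [← integral_indicator_one hlm, lateTerm]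
    refine integral_mono_ae ((integrable_const (1 : ℝ)).indicator hlm) hint ?_
    filter_upwards [ae_cond_mem hDm] with ω hω
    by_cases hω' : ω ∈ lateChange N T K tc
    · rw [Set.indicator_of_mem hω', Pi.one_apply]
      have h2 : rStar N K + 1 ≤ (changeRound N T (tc ω) : ℤ) := hω'
      have h3 : (rStar N K : ℝ) + 1 ≤ changeRound N T (tc ω) := by exact_mod_cast h2
      linarith
    · rw [Set.indicator_of_notMem hω', sub_nonneg]
      exact_mod_cast hω.1
  -- A late change lies inside `D`, so conditioning on `D` can only raise its probability; if `D` is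
  -- null, both sides vanish.
  have h2 : P.real (lateChange N T K tc) ≤ (cond P D).real (lateChange N T K tc) := by
    have h3 : P.real (lateChange N T K tc) = (cond P D).real (lateChange N T K tc) * P.real D := by
      rw [measureReal_def, measureReal_def, measureReal_def, ← ENNReal.toReal_mul,
        cond_mul_eq_inter hDm, Set.inter_eq_right.2 hsub]
    rw [h3]
    exact mul_le_of_le_one_right measureReal_nonneg measureReal_le_one
  exact ⟨h2.trans h1, measureReal_nonneg.trans h1⟩

end Early

end BeamSH

/-! ### Combination of the early and late bounds -/

theorem mainTheorem4 {Ω : Type*} [MeasurableSpace Ω] (P : Measure Ω) [IsProbabilityMeasure P]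
    (N T K : ℕ) (hN : ∃ L : ℕ, 1 ≤ L ∧ N = 2 ^ L) (hT : N * Nat.log 2 N ∣ T)
    (σ : ℝ) (hσ : 0 < σ)
    (μ : Fin N → ℝ) (hμ : ∀ i, 0 ≤ μ i) (k : Fin N) (hK : BeamSH.rank μ k = K)
    (μplus : ℝ) (hbest : ∀ i, i ≠ k → μ i < μplus)
    (tc : Ω → ℕ) (R : Fin N → ℕ → Ω → ℝ)
    (hmodel : BeamSH.IsChangeModel P T σ μ k μplus tc R) :
    P.real (BeamSH.errorEvent T μ k μplus tc R) =
        (cond P (BeamSH.earlyChange N T K tc)).real (BeamSH.errorEvent T μ k μplus tc R) *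
            P.real (BeamSH.earlyChange N T K tc) +
          (cond P (BeamSH.lateChange N T K tc)).real (BeamSH.errorEvent T μ k μplus tc R) *
            P.real (BeamSH.lateChange N T K tc) ∧
    P.real (BeamSH.errorEvent T μ k μplus tc R) ≤
        BeamSH.lateTerm P N T K tc +
          2 * (2 * Real.logb 2 (N : ℝ) + (K : ℝ) - 1) *
            Real.exp (-(1 / 2) * (BeamSH.deltaMin μ k μplus ^ 2 * (T : ℝ)) /
              (2 * BeamSH.sigmaMaxSq σ μ k μplus * ((N : ℝ) * Real.logb 2 (N : ℝ)))) ∧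
    (2 * BeamSH.sigmaMaxSq σ μ k μplus ≤ 1 →
      P.real (BeamSH.errorEvent T μ k μplus tc R) ≤
        BeamSH.lateTerm P N T K tc +
          2 * (2 * Real.logb 2 (N : ℝ) + (K : ℝ) - 1) *
            Real.exp (-(1 / 2) * (BeamSH.deltaMin μ k μplus ^ 2 * (T : ℝ)) /
              ((N : ℝ) * Real.logb 2 (N : ℝ)))) := by
  obtain ⟨L, hL, hNL⟩ := hN
  subst hK
  have hNlog : Nat.log 2 N = L := by rw [hNL, Nat.log_pow one_lt_two]
  have hlogb : Real.logb 2 (N : ℝ) = L := by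
    rw [hNL, Nat.cast_pow, Nat.cast_ofNat, Real.logb_pow, Real.logb_self_eq_one one_lt_two, mul_one]
  obtain ⟨m, hTm⟩ := hT
  rw [hNlog] at hTm
  have hNpos : (0 : ℝ) < N := by rw [hNL]; positivity
  have hLpos : (1 : ℝ) ≤ L := by exact_mod_cast hL
  have hKpos : (1 : ℝ) ≤ BeamSH.rank μ k := by
    exact_mod_cast (Nat.succ_pos _ : 0 < BeamSH.rank μ k)
  -- As N ≥ 2 there is a rival of `k`, with 0 ≤ μ i < μplus, so the maximal variance is positive.
  have hσpos : 0 < BeamSH.sigmaMaxSq σ μ k μplus := by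
    have hcard : 1 < Fintype.card (Fin N) := by
      rw [Fintype.card_fin, hNL]
      exact Nat.one_lt_two_pow (by omega)
    obtain ⟨i, hik⟩ := Fintype.exists_ne_of_one_lt_card hcard k
    exact BeamSH.sigmaMaxSq_pos hσ ((hμ i).trans_lt (hbest i hik))
  have hearlyMeas : MeasurableSet (BeamSH.earlyChange N T (BeamSH.rank μ k) tc) :=
    hmodel.measurable_tc
      (t := {s | (BeamSH.changeRound N T s : ℤ) ≤ BeamSH.rStar N (BeamSH.rank μ k)})
      MeasurableSet.of_discrete
  have hcompl : BeamSH.lateChange N T (BeamSH.rank μ k) tc =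
      (BeamSH.earlyChange N T (BeamSH.rank μ k) tc)ᶜ := by
    ext ω
    simp [BeamSH.lateChange, BeamSH.earlyChange]
  obtain ⟨hlate, hlate0⟩ := BeamSH.measureReal_lateChange_le_lateTerm (P := P) (T := T)
    (K := BeamSH.rank μ k) hNL hL hmodel.measurable_tc fun ω => by
      rw [BeamSH.roundEnd_eq hNL hL hTm le_rfl]
      exact (hmodel.tc_le ω).trans_eq (by rw [hTm]; ring)
  have hbound : P.real (BeamSH.errorEvent T μ k μplus tc R) ≤
      BeamSH.lateTerm P N T (BeamSH.rank μ k) tc +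
        2 * (2 * Real.logb 2 (N : ℝ) + (BeamSH.rank μ k : ℝ) - 1) *
          Real.exp (-(1 / 2) * (BeamSH.deltaMin μ k μplus ^ 2 * (T : ℝ)) /
            (2 * BeamSH.sigmaMaxSq σ μ k μplus * ((N : ℝ) * Real.logb 2 (N : ℝ)))) := by
    have hexp : -(1 / 2) * (BeamSH.deltaMin μ k μplus ^ 2 * (T : ℝ)) /
        (2 * BeamSH.sigmaMaxSq σ μ k μplus * ((N : ℝ) * L)) =
        -(m * BeamSH.deltaMin μ k μplus ^ 2) / (4 * BeamSH.sigmaMaxSq σ μ k μplus) := by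
      rw [hTm]
      push_cast
      field_simp
      ring
    rw [hlogb, hexp]
    -- For T = 0 every change counts as round 1 yet never takes effect, so the early argument fails;
    -- but the exponential is 1 and the bound exceeds 1.
    rcases Nat.eq_zero_or_pos m with hm | hm
    · simp only [hm, Nat.cast_zero, zero_mul, neg_zero, zero_div, Real.exp_zero]
      have := measureReal_le_one (μ := P) (s := BeamSH.errorEvent T μ k μplus tc R)
      linarith
    · rw [← measureReal_inter_add_sdiff hearlyMeas, add_comm]
      refine add_le_add ((measureReal_mono ?_).trans hlate)
        (BeamSH.measureReal_error_inter_early_le hNL hL hTm hm hσ hμ hbest hmodel)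
      rw [hcompl]
      exact fun ω hω => hω.2
  refine ⟨?_, hbound, fun hnorm => hbound.trans ?_⟩
  · rw [hcompl]
    simp only [measureReal_def]
    rw [← ENNReal.toReal_mul, ← ENNReal.toReal_mul, ← ENNReal.toReal_add (by finiteness)
      (by finiteness), cond_add_cond_compl_eq hearlyMeas]
  · rw [hlogb]
    have hcoef : (0 : ℝ) ≤ 2 * (2 * L + BeamSH.rank μ k - 1) := by linarith
    refine add_le_add_right (mul_le_mul_of_nonneg_left (Real.exp_le_exp.2 ?_) hcoef) _
    rw [neg_mul, neg_div, neg_div, neg_le_neg_iff]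
    refine div_le_div_of_nonneg_left (by positivity) (by positivity) ?_
    exact mul_le_of_le_one_left (by positivity) hnorm
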